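/- Let $p$ be an odd prime with $4\mid p-1$, let $q=p^r$ with $r\ge 1$, and let $R=\mathbb F_q[v]/\langle v^5-v\rangle$. Choose $a\in\mathbb F_q$ with $a^2=-1$, and let $\eta_1,\dots,\eta_5\in R$ be the orthogonal idempotents belonging to the factors $v,\ v-1,\ v+1,\ v-a,\ v+a$ of $v^5-v$ (so $\eta_i\equiv 1$ modulo the $i$-th factor and $\eta_i\equiv 0$ modulo the others); every $r\in R$ is uniquely $r=b_1\eta_1+\dots+b_5\eta_5$ with $b_i\in\mathbb F_q$. Define the Gray map $\phi:R\to\mathbb F_q^5$ by $\phi(r)=(b_1,\dots,b_5)M$ with $$M=\begin{pmatrix}6&2&3&-6&6\\6&6&2&3&-6\\-6&6&6&2&3\\3&-6&6&6&2\\2&3&-6&6&6\end{pmatrix},$$ and $\Phi:R^n\to\mathbb F_q^{5n}$ by $\Phi(r_0,\dots,r_{n-1})=(\phi(r_0),\dots,\phi(r_{n-1}))$. The Lee weight of $r\in R$ is the Hamming weight of $\phi(r)$, the Lee distance of $x,y\in R^n$ is the sum of the Lee weights of the $x_i-y_i$, and the minimum Lee distance of a code is the least Lee distance between distinct codewords.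 Let $C\subseteq R^n$ be a cyclic code, that is, an $R$-submodule mapped onto itself by the cyclic shift $(c_0,\dots,c_{n-1})\mapsto(c_{n-1},c_0,\dots,c_{n-2})$. Let $C^\perp=\{x\in R^n:\sum_i x_iy_i=0\text{ for all }y\in C\}$, let $k=\dim_{\mathbb F_q}\Phi(C)$, and let $d_L$ be the minimum Lee distance of $C$ (so $\Phi(C)$ is a $[5n,k,d_L]$ linear code over $\mathbb F_q$). **Theorem.** If $C^\perp\subseteq C$, then $2k\ge 5n$ and there exists a quantum error-correcting code with parameters $[\![5n,\,2k-5n,\,d_L]\!]_q$. Here an $[\![N,K,d]\!]_q$ quantum code is a subspace $Q$ of $(\mathbb C^q)^{\otimes N}$ of dimension $q^K$ with minimum distance $d$: with $P$ the orthogonal projector onto $Q$, $d$ is the least number $w$ such that some operator $E$ acting on only $w$ of the $N$ tensor factors (and as the identity on the others) is not detected by $Q$. The code detects $E$ if $PEP=cP$ for some $c\in\mathbb C$; when $K=0$ it is moreover required, as usual, that $c=\operatorname{tr}(E)/q^N$. -/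

import Mathlib

open Polynomial

noncomputable section

namespace GrayQuantum

/-! ## The ring `R = F[v] / (v⁵ - v)` and its idempotents -/

/-- The ring `R = F[v] / (v⁵ - v)`. -/
abbrev R (F : Type*) [Field F] : Type _ := AdjoinRoot (X ^ 5 - X : F[X])

/-- The roots `0, 1, -1, a, -a` of `v⁵ - v`, where `a² = -1`. -/
def rt {F : Type*} [Field F] (a : F) : Fin 5 → F := ![0, 1, -1, a, -a]

/-- The linear factors `f₁ = v, f₂ = v - 1, f₃ = v + 1, f₄ = v - a, f₅ = v + a`. -/
def fac {F : Type*} [Field F] (a : F) (i : Fin 5) : F[X] := X - C (rt a i)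

/-- The complementary factor `(v⁵ - v) / fᵢ`, as the product of the other linear factors. -/
def facHat {F : Type*} [Field F] (a : F) (i : Fin 5) : F[X] := ∏ j ∈ Finset.univ.erase i, fac a j

/-- A Bézout coefficient `βᵢ`, with `αᵢ fᵢ + βᵢ f̂ᵢ = 1` for some `αᵢ`. -/
def bez {F : Type*} [Field F] (a : F) (i : Fin 5) : F[X] := C ((facHat a i).eval (rt a i))⁻¹

/-- The idempotent `ηᵢ = βᵢ f̂ᵢ` of `R`. -/
def eta {F : Type*} [Field F] (a : F) (i : Fin 5) : R F :=
  AdjoinRoot.mk (X ^ 5 - X : F[X]) (bez a i * facHat a i)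

theorem rt_pow {F : Type*} [Field F] {a : F} (ha : a ^ 2 = -1) (i : Fin 5) :
    rt a i ^ 5 - rt a i = 0 := by
  have h5 : a ^ 5 = a := by
    have : a ^ 5 = a ^ 2 * a ^ 2 * a := by ring
    rw [this, ha]; ring
  fin_cases i
  · simp [rt]
  · simp [rt]
  · have h : (-1 : F) ^ 5 = -1 := by ring
    simp [rt, h]
  · simp [rt, h5]
  · have h : (-a) ^ 5 = -a ^ 5 := by ring
    simp [rt, h, h5]

/-- The coordinate `bᵢ` of `r = b₁ η₁ + ⋯ + b₅ η₅`: the value of `r` at the `i`-th root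
(see `sum_coord_smul_eta` and `eq_coord_of_eq_sum`). -/
def coord {F : Type*} [Field F] {a : F} (ha : a ^ 2 = -1) (i : Fin 5) : R F →ₐ[F] F :=
  AdjoinRoot.liftAlgHom (X ^ 5 - X : F[X]) (Algebra.ofId F F) (rt a i) (by
    simpa [Algebra.ofId_apply] using rt_pow ha i)

theorem coord_mk {F : Type*} [Field F] {a : F} (ha : a ^ 2 = -1) (i : Fin 5) (g : F[X]) :
    coord ha i (AdjoinRoot.mk _ g) = g.eval (rt a i) := by
  rw [coord, AdjoinRoot.liftAlgHom_mk]
  rfl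

theorem rt_injective {F : Type*} [Field F] (h2 : (2 : F) ≠ 0) {a : F} (ha : a ^ 2 = -1) :
    Function.Injective (rt a) := by
  have h0 : a ≠ 0 := by rintro rfl; norm_num at ha
  have hsq : a ^ 2 ≠ 1 := by
    intro h; apply h2; linear_combination ha - h
  have h1 : a ≠ 1 := by rintro rfl; norm_num at hsq
  have h1' : a ≠ -1 := by rintro rfl; norm_num at hsq
  have e1 : (1 : F) ≠ -1 := by intro h; apply h2; linear_combination h
  have ea : a ≠ -a := by
    intro h
    have : (2 : F) * a = 0 := by linear_combination h
    exact (mul_ne_zero h2 h0) this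
  have h1'' : -a ≠ 1 := fun h => h1' (by linear_combination -h)
  have h1''' : -a ≠ -1 := fun h => h1 (by linear_combination -h)
  intro i j hij
  have n1 : (0 : F) ≠ -1 := by simp
  have n2 : (0 : F) ≠ -a := by simpa using h0
  have n3 : (-1 : F) ≠ -a := h1'''.symm
  fin_cases i <;> fin_cases j <;> first
    | rfl
    | exact absurd hij (by
        simp only [rt]
        first
          | exact zero_ne_one | exact n1 | exact h0.symm | exact n2
          | exact one_ne_zero | exact e1 | exact h1.symm | exact h1''.symm
          | exact n1.symm | exact e1.symm | exact h1'.symm | exact n3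
          | exact h0 | exact h1 | exact h1' | exact ea
          | exact n2.symm | exact h1'' | exact h1''' | exact ea.symm)

theorem prod_fac {F : Type*} [Field F] {a : F} (ha : a ^ 2 = -1) :
    ∏ i, fac a i = X ^ 5 - X := by
  have h : (C a : F[X]) ^ 2 = -1 := by rw [← C_pow, ha]; simp
  simp [Fin.prod_univ_five, fac, rt]
  linear_combination (-X ^ 3 + X) * h

theorem fac_mul_facHat {F : Type*} [Field F] {a : F} (ha : a ^ 2 = -1) (i : Fin 5) :
    fac a i * facHat a i = X ^ 5 - X := by
  rw [← prod_fac ha, facHat, Finset.mul_prod_erase _ _ (Finset.mem_univ i)]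

theorem eval_facHat_ne_zero {F : Type*} [Field F] (h2 : (2 : F) ≠ 0) {a : F} (ha : a ^ 2 = -1)
    (i : Fin 5) : (facHat a i).eval (rt a i) ≠ 0 := by
  rw [facHat, eval_prod, Finset.prod_ne_zero_iff]
  intro j hj
  simp only [fac, eval_sub, eval_X, eval_C]
  exact sub_ne_zero.2 fun h => (Finset.ne_of_mem_erase hj) (rt_injective h2 ha h).symm

/-- `bez` is a Bézout coefficient. -/
theorem exists_bezout {F : Type*} [Field F] (h2 : (2 : F) ≠ 0) {a : F} (ha : a ^ 2 = -1)
    (i : Fin 5) : ∃ α : F[X], α * fac a i + bez a i * facHat a i = 1 := by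
  have : fac a i ∣ 1 - bez a i * facHat a i := by
    rw [fac, dvd_iff_isRoot]
    simp [bez, inv_mul_cancel₀ (eval_facHat_ne_zero h2 ha i)]
  obtain ⟨α, h⟩ := this
  exact ⟨α, by linear_combination -h⟩

theorem coord_eta {F : Type*} [Field F] (h2 : (2 : F) ≠ 0) {a : F} (ha : a ^ 2 = -1)
    (i j : Fin 5) : coord ha i (eta a j) = if i = j then 1 else 0 := by
  rw [eta, coord_mk]
  split_ifs with h
  · subst h
    simp [bez, inv_mul_cancel₀ (eval_facHat_ne_zero h2 ha i)]
  · rw [eval_mul, facHat, eval_prod,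
      Finset.prod_eq_zero (Finset.mem_erase.2 ⟨h, Finset.mem_univ i⟩) (by simp [fac]), mul_zero]

theorem coord_ext {F : Type*} [Field F] (h2 : (2 : F) ≠ 0) {a : F} (ha : a ^ 2 = -1)
    {r s : R F} (h : ∀ i, coord ha i r = coord ha i s) : r = s := by
  obtain ⟨g, rfl⟩ := AdjoinRoot.mk_surjective r
  obtain ⟨g', rfl⟩ := AdjoinRoot.mk_surjective s
  rw [AdjoinRoot.mk_eq_mk, ← prod_fac ha]
  refine Finset.prod_dvd_of_coprime (fun i _ j _ hij => ?_) fun i _ => ?_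
  · exact isCoprime_X_sub_C_of_isUnit_sub
      (sub_ne_zero.2 fun hh => hij (rt_injective h2 ha hh)).isUnit
  · rw [fac, dvd_iff_isRoot]
    have := h i
    rw [coord_mk, coord_mk] at this
    simp [this]

/-- Every `r ∈ R` is `b₁ η₁ + ⋯ + b₅ η₅` with `bᵢ = coord i r`. -/
theorem sum_coord_smul_eta {F : Type*} [Field F] (h2 : (2 : F) ≠ 0) {a : F} (ha : a ^ 2 = -1)
    (r : R F) : r = ∑ i, coord ha i r • eta a i := by
  refine coord_ext h2 ha fun i => ?_
  simp [map_sum, coord_eta h2 ha]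

/-- The coordinates in `r = b₁ η₁ + ⋯ + b₅ η₅` are unique. -/
theorem eq_coord_of_eq_sum {F : Type*} [Field F] (h2 : (2 : F) ≠ 0) {a : F} (ha : a ^ 2 = -1)
    (r : R F) (b : Fin 5 → F) (h : r = ∑ i, b i • eta a i) (i : Fin 5) : b i = coord ha i r := by
  rw [h]
  simp [map_sum, coord_eta h2 ha]

/-! ## The Gray map and the Lee distance -/

/-- The matrix of the Gray map. -/
def grayMatrix (F : Type*) [Field F] : Matrix (Fin 5) (Fin 5) F :=
  !![6, 2, 3, -6, 6;
     6, 6, 2, 3, -6;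
     -6, 6, 6, 2, 3;
     3, -6, 6, 6, 2;
     2, 3, -6, 6, 6]

/-- The Gray map `φ : R → F⁵`, `r = ∑ bᵢ ηᵢ ↦ (b₁, …, b₅) M`. -/
def gray {F : Type*} [Field F] {a : F} (ha : a ^ 2 = -1) : R F →ₗ[F] (Fin 5 → F) :=
  (grayMatrix F).vecMulLinear ∘ₗ LinearMap.pi fun i => (coord ha i).toLinearMap

/-- The Gray map `Φ : Rⁿ → F⁵ⁿ`, `(r₀, …, rₙ₋₁) ↦ (φ(r₀), …, φ(rₙ₋₁))`: the entry in position
`m` is the entry in position `m % 5` of `φ(r_{m / 5})`. -/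
def grayVec {F : Type*} [Field F] {a : F} (ha : a ^ 2 = -1) (n : ℕ) :
    (Fin n → R F) →ₗ[F] (Fin (5 * n) → F) where
  toFun r m :=
    gray ha (r (Fin.cast (Nat.mul_comm 5 n) m).divNat) (Fin.cast (Nat.mul_comm 5 n) m).modNat
  map_add' r s := by ext m; simp
  map_smul' c r := by ext m; simp

/-- The Lee weight of an element of `R`. -/
def leeWeight {F : Type*} [Field F] [DecidableEq F] {a : F} (ha : a ^ 2 = -1) (r : R F) : ℕ :=
  hammingNorm (gray ha r)

/-- The Lee distance on `Rⁿ`. -/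
def leeDist {F : Type*} [Field F] [DecidableEq F] {a : F} (ha : a ^ 2 = -1) {n : ℕ}
    (x y : Fin n → R F) : ℕ :=
  ∑ i, leeWeight ha (x i - y i)

/-- `d` is the minimum Lee distance of the code `C`. -/
def IsMinLeeDist {F : Type*} [Field F] [DecidableEq F] {a : F} (ha : a ^ 2 = -1) {n : ℕ}
    (C : Submodule (R F) (Fin n → R F)) (d : ℕ) : Prop :=
  IsLeast {w | ∃ x ∈ C, ∃ y ∈ C, x ≠ y ∧ leeDist ha x y = w} d

/-! ## Cyclic codes and dual codes -/

/-- The cyclic shift `(c₀, c₁, …, cₙ₋₁) ↦ (cₙ₋₁, c₀, …, cₙ₋₂)`. -/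
def shift (A : Type*) [CommRing A] (n : ℕ) : (Fin n → A) →ₗ[A] (Fin n → A) :=
  LinearMap.funLeft A A (finRotate n).symm

/-- A linear code is cyclic if it is mapped onto itself by the cyclic shift. -/
def IsCyclicCode {A : Type*} [CommRing A] {n : ℕ} (C : Submodule A (Fin n → A)) : Prop :=
  C.map (shift A n) = C

/-- The dual code. -/
def dualCode {A : Type*} [CommRing A] {n : ℕ} (C : Submodule A (Fin n → A)) :
    Submodule A (Fin n → A) where
  carrier := {x | ∀ y ∈ C, x ⬝ᵥ y = 0}
  add_mem' hx hy z hz := by rw [add_dotProduct, hx z hz, hy z hz, add_zero]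
  zero_mem' z _ := zero_dotProduct z
  smul_mem' c x hx z hz := by rw [smul_dotProduct, hx z hz, smul_zero]

/-! ## Quantum codes -/

/-- The Hilbert space `(ℂ^q)^{⊗ N}` in its computational basis `|x₁ … x_N⟩`, `xᵢ ∈ F`, where
`q = |F|`. -/
abbrev QSpace (F : Type*) (N : ℕ) : Type _ := EuclideanSpace ℂ (Fin N → F)

/-- The operator `E` on `(ℂ^q)^{⊗ N}` acts only on the tensor factors in `S`: it is `B ⊗ 1` with
`B` an operator on the factors in `S` and `1` the identity on the other factors. -/
def ActsOn {F : Type*} [DecidableEq F] {N : ℕ} (S : Finset (Fin N))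
    (E : Matrix (Fin N → F) (Fin N → F) ℂ) : Prop :=
  ∃ B : Matrix (S → F) (S → F) ℂ, ∀ x y : Fin N → F,
    E x y = if ∀ i ∉ S, x i = y i then B (fun i => x i) (fun i => y i) else 0

/-- With `P` the orthogonal projector onto `Q`, this says that `P E P = c P`. -/
def CompressesTo {F : Type*} [Fintype F] [DecidableEq F] {N : ℕ} (Q : Submodule ℂ (QSpace F N))
    (E : Matrix (Fin N → F) (Fin N → F) ℂ) (c : ℂ) : Prop :=
  ∀ u ∈ Q, ∀ w ∈ Q, inner ℂ u (Matrix.toEuclideanLin E w) = c * inner ℂ u w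

/-- The code `Q` detects the error `E`: `P E P = c P` for some scalar `c`. This is void if
`dim Q = 1`; as usual, such a code is required to be pure, that is `c = tr(E) / q^N`. -/
def Detects {F : Type*} [Fintype F] [DecidableEq F] {N : ℕ} (Q : Submodule ℂ (QSpace F N))
    (E : Matrix (Fin N → F) (Fin N → F) ℂ) : Prop :=
  ∃ c : ℂ, CompressesTo Q E c ∧
    (Module.finrank ℂ Q = 1 → c = E.trace / (Fintype.card F : ℂ) ^ N)

/-- `d` is the minimum distance of the quantum code `Q`: the least number of tensor factors on
which an undetected error acts. -/
def IsQuantumMinDist {F : Type*} [Fintype F] [DecidableEq F] {N : ℕ}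
    (Q : Submodule ℂ (QSpace F N)) (d : ℕ) : Prop :=
  IsLeast {w | ∃ (S : Finset (Fin N)) (E : Matrix (Fin N → F) (Fin N → F) ℂ),
    S.card = w ∧ ActsOn S E ∧ ¬ Detects Q E} d

/-- `Q` is an `⟦N, K, d⟧_q` quantum code, `q = |F|`: a subspace of `(ℂ^q)^{⊗ N}` of dimension
`q^K` with minimum distance `d`. -/
def IsQuantumCode {F : Type*} [Fintype F] [DecidableEq F] {N : ℕ}
    (Q : Submodule ℂ (QSpace F N)) (K d : ℕ) : Prop :=
  Module.finrank ℂ Q = Fintype.card F ^ K ∧ IsQuantumMinDist Q d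

end GrayQuantum

end

noncomputable section

namespace GrayQuantum

/-! ## Duality of linear codes over a field -/

section Duality

variable {F : Type*} [Field F] {N : ℕ}

/-! The Gray matrix satisfies `M * Mᵀ = 121`, and `121 = 11²` is nonzero in `F` because `p ≡ 1 mod
4` excludes `p = 11`. The coordinates are ring homomorphisms, so the dot product of two Gray images
is `121` times the sum of the coordinates of the dot product over `R`
(`grayVec_dotProduct_grayVec`). This trace form is nondegenerate and `C` is an `R`-module, so the
dual of `D = Φ(C)` lies in `Φ(C^⊥)`, hence in `D`; this gives `2k ≥ 5n`. Linearity and injectivity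
make `d` the least nonzero weight of `D`.

The CSS code of `dualCode D ≤ D` has dimension `q^(2k - 5n)`. If `D` is self-dual, the purity clause
makes its distance exactly `d`. Otherwise its distance is the least weight in `D` outside `dualCode
D`, which may exceed `d`, whereas the distance must equal `d`. Shears of `Fᴺ` then lower it one unit
at a time (`IsCSSPair.exists_pred`). They do not preserve the duality between the two codes, so the
CSS theory is set up for arbitrary pairs `A ≤ B`. -/

theorem dualCode_eq_comap (W : Submodule F (Fin N → F)) :
    dualCode W = W.dualAnnihilator.comap (dotProductEquiv F (Fin N)).toLinearMap := by
  ext x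
  simp [Submodule.mem_dualAnnihilator, dualCode]

theorem finrank_add_finrank_dualCode (W : Submodule F (Fin N → F)) :
    Module.finrank F W + Module.finrank F (dualCode W) = N := by
  have h := Subspace.finrank_add_finrank_dualAnnihilator_eq W
  rw [Module.finrank_fin_fun] at h
  rwa [dualCode_eq_comap, Submodule.comap_equiv_eq_map_symm, LinearEquiv.finrank_map_eq]

theorem dualCode_dualCode (W : Submodule F (Fin N → F)) : dualCode (dualCode W) = W := by
  have hle : W ≤ dualCode (dualCode W) := fun x hx y hy => by
    rw [dotProduct_comm]; exact hy x hx
  refine (Submodule.eq_of_le_of_finrank_eq hle ?_).symm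
  have h1 := finrank_add_finrank_dualCode W
  have h2 := finrank_add_finrank_dualCode (dualCode W)
  omega

/-- A vector agrees on `S` with some word of `W` as soon as it is orthogonal to the words of the
dual code that are supported on `S`. -/
theorem exists_mem_eqOn_of_dotProduct_eq_zero (W : Submodule F (Fin N → F)) (S : Finset (Fin N))
    (x : Fin N → F)
    (h : ∀ v ∈ dualCode W, (∀ i ∉ S, v i = 0) → v ⬝ᵥ x = 0) : ∃ w ∈ W, ∀ i ∈ S, x i = w i := by
  classical
  -- The dual of `W ⊔ Z` consists of the words of `dualCode W` supported on `S`, so biduality puts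
  -- `x` in `W ⊔ Z`.
  let Z : Submodule F (Fin N → F) :=
    { carrier := {z | ∀ i ∈ S, z i = 0}
      add_mem' := fun hx hy i hi => by simp [hx i hi, hy i hi]
      zero_mem' := fun i _ => rfl
      smul_mem' := fun c x hx i hi => by simp [hx i hi] }
  have hx : x ∈ W ⊔ Z := by
    rw [← dualCode_dualCode (W ⊔ Z)]
    intro v hv
    rw [dotProduct_comm]
    refine h v (fun w hw => hv w (Submodule.mem_sup_left hw)) fun i hi => ?_
    have hZ : Pi.single i (1 : F) ∈ Z := fun j hj => by
      rw [Pi.single_apply, if_neg]; rintro rfl; exact hi hj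
    simpa using hv _ (Submodule.mem_sup_right hZ)
  obtain ⟨w, hw, z, hz, rfl⟩ := Submodule.mem_sup.1 hx
  exact ⟨w, hw, fun i hi => by simp [hz i hi]⟩

end Duality

/-! ## Calderbank–Shor–Steane codes -/

section CSS

variable {F : Type*} [Field F] {N : ℕ}

open Classical in
/-- The state of `(ℂ^q)^{⊗ N}` with a given amplitude on each coset of `A` in `B`. -/
def cssState (A B : Submodule F (Fin N → F)) :
    ((B ⧸ A.submoduleOf B) → ℂ) →ₗ[ℂ] QSpace F N where
  toFun φ := WithLp.toLp 2 fun x =>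
    if h : x ∈ B then φ (Submodule.Quotient.mk ⟨x, h⟩) else 0
  map_add' φ ψ := by
    ext x; by_cases h : x ∈ B <;> simp [h]
  map_smul' c φ := by
    ext x; by_cases h : x ∈ B <;> simp [h]

/-- The CSS code of a pair of codes `A ≤ B`: the states that are supported on `B` and invariant
under translation by `A`. -/
def cssCode (A B : Submodule F (Fin N → F)) : Submodule ℂ (QSpace F N) :=
  LinearMap.range (cssState A B)

variable {A B : Submodule F (Fin N → F)}

theorem cssState_injective (A B : Submodule F (Fin N → F)) :
    Function.Injective (cssState A B) := by
  intro φ ψ h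
  funext c
  obtain ⟨⟨x, hx⟩, rfl⟩ := Submodule.Quotient.mk_surjective _ c
  have := congrArg (fun s : QSpace F N => s x) h
  simpa [cssState, hx] using this

theorem cssCode_apply_of_notMem {u : QSpace F N} (hu : u ∈ cssCode A B) {x : Fin N → F}
    (hx : x ∉ B) : u x = 0 := by
  obtain ⟨φ, rfl⟩ := hu
  simp [cssState, hx]

theorem cssCode_apply_add (hAB : A ≤ B) {u : QSpace F N} (hu : u ∈ cssCode A B) {e : Fin N → F}
    (he : e ∈ A) (x : Fin N → F) : u (x + e) = u x := by
  obtain ⟨φ, rfl⟩ := hu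
  by_cases hx : x ∈ B
  · have hxe : x + e ∈ B := B.add_mem hx (hAB he)
    simp only [cssState, LinearMap.coe_mk, AddHom.coe_mk, hx, hxe, dif_pos]
    congr 1
    rw [Submodule.Quotient.eq]
    simpa [Submodule.submoduleOf] using he
  · have hxe : x + e ∉ B := fun h => hx (by simpa using B.sub_mem h (hAB he))
    simp [cssState, hx, hxe]

/-- The uniform superposition of a coset of `A` in `B` is a code state. -/
theorem exists_mem_cssCode_coset (hAB : A ≤ B) {b : Fin N → F} (hb : b ∈ B) :
    ∃ u ∈ cssCode A B, (∀ x, x - b ∈ A → u x = 1) ∧ ∀ x, x - b ∉ A → u x = 0 := by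
  classical
  refine ⟨cssState A B (Pi.single (Submodule.Quotient.mk ⟨b, hb⟩) 1), ⟨_, rfl⟩, fun x hx => ?_,
    fun x hx => ?_⟩
  · have hxB : x ∈ B := by simpa using B.add_mem (hAB hx) hb
    have : (Submodule.Quotient.mk ⟨x, hxB⟩ : B ⧸ A.submoduleOf B) =
        Submodule.Quotient.mk ⟨b, hb⟩ := by
      rw [Submodule.Quotient.eq]; simpa [Submodule.submoduleOf] using hx
    simp [cssState, hxB, this]
  · by_cases hxB : x ∈ B
    · have : (Submodule.Quotient.mk ⟨x, hxB⟩ : B ⧸ A.submoduleOf B) ≠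
          Submodule.Quotient.mk ⟨b, hb⟩ := by
        rw [Ne, Submodule.Quotient.eq]; simpa [Submodule.submoduleOf] using hx
      simp [cssState, hxB, this]
    · simp [cssState, hxB]

theorem hammingNorm_le_card [DecidableEq F] {S : Finset (Fin N)} {x : Fin N → F}
    (h : ∀ i ∉ S, x i = 0) :
    hammingNorm x ≤ S.card :=
  Finset.card_le_card fun i hi => by
    by_contra hS
    exact (Finset.mem_filter.1 hi).2 (h i hS)

theorem ActsOn.apply_eq_zero [DecidableEq F] {S : Finset (Fin N)}
    {E : Matrix (Fin N → F) (Fin N → F) ℂ} (hE : ActsOn S E)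
    {x y : Fin N → F} {i : Fin N} (hi : i ∉ S)
    (h : x i ≠ y i) : E x y = 0 := by
  obtain ⟨M, hM⟩ := hE
  rw [hM, if_neg fun hh => h (hh i hi)]

theorem ActsOn.apply_add_congr [DecidableEq F] {S : Finset (Fin N)}
    {E : Matrix (Fin N → F) (Fin N → F) ℂ} (hE : ActsOn S E)
    {x y : Fin N → F} (h : ∀ i ∈ S, x i = y i)
    (e : Fin N → F) : E x (x + e) = E y (y + e) := by
  obtain ⟨M, hM⟩ := hE
  have h1 : (fun i : S => x i) = fun i : S => y i := funext fun i => h i.1 i.2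
  have h2 : (fun i : S => (x + e) i) = fun i : S => (y + e) i :=
    funext fun i => by simp [h i.1 i.2]
  rw [hM, hM, h1, h2]
  simp

variable [Fintype F] [DecidableEq F]

theorem finrank_cssCode (hAB : A ≤ B) :
    Module.finrank ℂ (cssCode A B) =
      Fintype.card F ^ (Module.finrank F B - Module.finrank F A) := by
  classical
  have : Fintype (B ⧸ A.submoduleOf B) := Fintype.ofFinite _
  rw [cssCode, LinearMap.finrank_range_of_inj (cssState_injective A B), Module.finrank_pi,
    Module.card_eq_pow_finrank (K := F)]
  congr 1
  have h1 := Submodule.finrank_quotient_add_finrank (A.submoduleOf B)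
  have h2 := (Submodule.submoduleOfEquivOfLe hAB).finrank_eq
  omega

theorem inner_toEuclideanLin (E : Matrix (Fin N → F) (Fin N → F) ℂ) (u w : QSpace F N) :
    inner ℂ u (Matrix.toEuclideanLin E w) = ∑ x, star (u x) * ∑ y, E x y * w y := by
  simp [PiLp.inner_apply, Matrix.toLpLin_apply, Matrix.mulVec, dotProduct, mul_comm]

theorem inner_qspace (u w : QSpace F N) : inner ℂ u w = ∑ x, star (u x) * w x := by
  simp [PiLp.inner_apply, mul_comm]

/-! ### Errors detected by a CSS code -/

section Detection

variable {S : Finset (Fin N)} {E : Matrix (Fin N → F) (Fin N → F) ℂ}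

-- An entry `E x (x + e)` with `x, x + e ∈ B` can be nonzero only if `e` is supported on `S`, so `e
-- ∈ A` by `h1`, and `w` is invariant under `e`. Thus `E` acts on `w` at `x` as multiplication by a
-- row sum. Averaging over translations by `A`, which fix `u` and `w`, makes this factor independent
-- of `x`: by `h2`, `x` looks like a word of `A` on `S`.
open Classical in
theorem compressesTo_cssCode (hAB : A ≤ B) (hE : ActsOn S E)
    (h1 : ∀ x ∈ B, (∀ i ∉ S, x i = 0) → x ∈ A)
    (h2 : ∀ x ∈ B, ∃ a ∈ A, ∀ i ∈ S, x i = a i) :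
    CompressesTo (cssCode A B) E
      ((∑ b : A, ∑ e : A, E b (b + e)) / Fintype.card A) := by
  intro u hu w hw
  have key : ∀ x ∈ B, ∑ y, E x y * w y = w x * ∑ e : A, E x (x + e) := by
    intro x hx
    rw [← Equiv.sum_comp (Equiv.addLeft x), Finset.mul_sum,
      ← Finset.sum_subset (Finset.subset_univ (Finset.univ.filter (· ∈ A)))]
    · rw [Finset.sum_subtype (p := (· ∈ A)) _ (by simp)]
      refine Finset.sum_congr rfl fun e _ => ?_
      simp [cssCode_apply_add hAB hw e.2, mul_comm]
    · intro e _ he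
      simp only [Finset.mem_filter, Finset.mem_univ, true_and] at he
      by_cases hxe : x + e ∈ B
      · obtain ⟨i, hi, hne⟩ : ∃ i, i ∉ S ∧ e i ≠ 0 := by
          by_contra! hcon
          exact he (h1 e (by simpa using B.sub_mem hxe hx) hcon)
        rw [Equiv.coe_addLeft, hE.apply_eq_zero hi (by simpa using hne), zero_mul]
      · rw [Equiv.coe_addLeft, cssCode_apply_of_notMem hw hxe, mul_zero]
  have hf : ∀ x ∈ B, ∑ b : A, ∑ e : A, E (x + b) (x + b + e) =
      ∑ b : A, ∑ e : A, E b (b + e) := by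
    intro x hx
    obtain ⟨b₀, hb₀, hxb⟩ := h2 x hx
    rw [← Equiv.sum_comp (Equiv.addLeft (⟨b₀, hb₀⟩ : A)) fun b : A => ∑ e : A, E b (b + e)]
    refine Finset.sum_congr rfl fun b _ => Finset.sum_congr rfl fun e _ => ?_
    exact hE.apply_add_congr (fun i hi => by simp [hxb i hi]) _
  have hcard : (Fintype.card A : ℂ) ≠ 0 := Nat.cast_ne_zero.2 Fintype.card_ne_zero
  have hsum : ∀ b : A, ∑ x, star (u x) * (w x * ∑ e : A, E x (x + e)) =
      ∑ x, star (u x) * (w x * ∑ e : A, E (x + b) (x + b + e)) := by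
    intro b
    rw [← Equiv.sum_comp (Equiv.addRight (b : Fin N → F))]
    refine Finset.sum_congr rfl fun x _ => ?_
    simp [cssCode_apply_add hAB hu b.2, cssCode_apply_add hAB hw b.2]
  rw [inner_toEuclideanLin, inner_qspace, div_mul_eq_mul_div, eq_div_iff hcard]
  calc (∑ x, star (u x) * ∑ y, E x y * w y) * Fintype.card A
      = ∑ b : A, ∑ x, star (u x) * (w x * ∑ e : A, E x (x + e)) := by
        rw [Finset.sum_const, Finset.card_univ, nsmul_eq_mul, mul_comm]
        congr 1
        refine Finset.sum_congr rfl fun x _ => ?_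
        by_cases hx : x ∈ B
        · rw [key x hx]
        · simp [cssCode_apply_of_notMem hu hx]
    _ = ∑ x, ∑ b : A, star (u x) * (w x * ∑ e : A, E (x + b) (x + b + e)) := by
        rw [Finset.sum_congr rfl fun b _ => hsum b, Finset.sum_comm]
    _ = _ := by
        rw [Finset.mul_sum]
        refine Finset.sum_congr rfl fun x _ => ?_
        by_cases hx : x ∈ B
        · rw [← Finset.mul_sum, ← Finset.mul_sum, hf x hx]; ring
        · simp [cssCode_apply_of_notMem hu hx]

open Classical in
/-- If `A` has no nonzero word supported on `S`, and its restriction to `S` is everything, then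
the average of an operator on `S` over `A` is its normalized trace. -/
theorem sum_div_card_eq_trace (hE : ActsOn S E)
    (h1 : ∀ x ∈ A, (∀ i ∉ S, x i = 0) → x = 0)
    (h2 : ∀ x : Fin N → F, ∃ a ∈ A, ∀ i ∈ S, x i = a i) :
    (∑ b : A, ∑ e : A, E b (b + e)) / Fintype.card A =
      E.trace / (Fintype.card F : ℂ) ^ N := by
  -- Off-diagonal terms vanish, since a nonzero `e ∈ A` moves some coordinate outside `S`.
  have hdiag : ∀ b : A, ∑ e : A, E b (b + e) = E b b := by
    intro b
    rw [Finset.sum_eq_single 0]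
    · simp
    · intro e _ he
      obtain ⟨i, hi, hne⟩ : ∃ i, i ∉ S ∧ (e : Fin N → F) i ≠ 0 := by
        by_contra! hcon
        exact he (Subtype.ext (h1 e e.2 hcon))
      exact hE.apply_eq_zero hi (by simpa using hne)
    · simp
  have hf : ∀ x, ∑ b : A, E (x + b) (x + b) = ∑ b : A, E b b := by
    intro x
    obtain ⟨b₀, hb₀, hxb⟩ := h2 x
    rw [← Equiv.sum_comp (Equiv.addLeft (⟨b₀, hb₀⟩ : A)) fun b : A => E b b]
    refine Finset.sum_congr rfl fun b _ => ?_
    simpa using hE.apply_add_congr (x := x + b) (y := b₀ + b)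
      (fun i hi => by simp [hxb i hi]) 0
  have hcard : (Fintype.card A : ℂ) ≠ 0 := Nat.cast_ne_zero.2 Fintype.card_ne_zero
  have hq : (Fintype.card F : ℂ) ^ N ≠ 0 :=
    pow_ne_zero _ (Nat.cast_ne_zero.2 Fintype.card_ne_zero)
  rw [Finset.sum_congr rfl fun b _ => hdiag b, div_eq_div_iff hcard hq]
  calc (∑ b : A, E b b) * (Fintype.card F : ℂ) ^ N
      = ∑ x : Fin N → F, ∑ b : A, E (x + b) (x + b) := by
        rw [Finset.sum_congr rfl fun x _ => hf x]
        simp [mul_comm]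
    _ = ∑ b : A, E.trace := by
        rw [Finset.sum_comm]
        refine Finset.sum_congr rfl fun b _ => ?_
        exact Equiv.sum_comp (Equiv.addRight (b : Fin N → F)) fun x => E x x
    _ = _ := by simp [mul_comm]

end Detection

/-! ### Translations as undetected errors -/

/-- The support of a vector. -/
def supp (e : Fin N → F) : Finset (Fin N) := Finset.univ.filter (e · ≠ 0)

/-- The operator that translates computational basis states by `e`. -/
def translation (e : Fin N → F) : Matrix (Fin N → F) (Fin N → F) ℂ :=
  fun x y => if x = y + e then 1 else 0

theorem actsOn_translation (e : Fin N → F) : ActsOn (supp e) (translation e) := by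
  refine ⟨fun x y => if ∀ i, x i = y i + e i then 1 else 0, fun x y => ?_⟩
  have hsupp : ∀ i, i ∉ supp e ↔ e i = 0 := fun i => by simp [supp]
  by_cases h : x = y + e
  · subst h
    have h0 : ∀ i ∉ supp e, (y + e) i = y i := fun i hi => by
      simp [(hsupp i).1 hi]
    rw [if_pos h0]
    simp [translation]
  · rw [translation, if_neg h]
    split_ifs with h1
    · refine (if_neg fun h2 => h (funext fun i => ?_)).symm
      by_cases hi : i ∈ supp e
      · exact h2 ⟨i, hi⟩
      · simp [h1 i hi, (hsupp i).1 hi]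
    · rfl

theorem inner_translation (e : Fin N → F) (u w : QSpace F N) :
    inner ℂ u (Matrix.toEuclideanLin (translation e) w) = ∑ x, star (u x) * w (x - e) := by
  rw [inner_toEuclideanLin]
  refine Finset.sum_congr rfl fun x _ => ?_
  rw [Finset.sum_eq_single (x - e)]
  · simp [translation]
  · intro y _ hy
    rw [translation, if_neg, zero_mul]
    rintro rfl
    simp at hy
  · simp

theorem sum_star_mul_self_ne_zero {u : QSpace F N} (h : ∃ x, u x ≠ 0) :
    ∑ x, star (u x) * u x ≠ 0 := by
  rw [← inner_qspace, inner_self_ne_zero]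
  rintro rfl
  simp at h

/-- The translation carries the state of the coset `A` to that of `e + A`, an orthogonal nonzero
code state, which no scalar `c` allows. -/
theorem not_detects_translation (hAB : A ≤ B) {e : Fin N → F} (he : e ∈ B) (heA : e ∉ A) :
    ¬ Detects (cssCode A B) (translation e) := by
  rintro ⟨c, hc, -⟩
  obtain ⟨u, hu, hu1, hu0⟩ := exists_mem_cssCode_coset hAB he
  obtain ⟨w, hw, hw1, hw0⟩ := exists_mem_cssCode_coset hAB B.zero_mem
  have h := hc u hu w hw
  have huw : ∀ x, w (x - e) = u x := fun x => by
    by_cases hx : x - e ∈ A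
    · rw [hu1 x hx, hw1 _ (by simpa using hx)]
    · rw [hu0 x hx, hw0 _ (by simpa using hx)]
  have horth : ∀ x, star (u x) * w x = 0 := fun x => by
    by_cases hx : x - e ∈ A
    · rw [hw0 x, mul_zero]
      intro hxA
      exact heA (by simpa using A.sub_mem hxA hx)
    · rw [hu0 x hx]; simp
  rw [inner_translation, inner_qspace, Finset.sum_congr rfl fun x _ => horth x] at h
  simp only [huw, Finset.sum_const_zero, mul_zero] at h
  exact sum_star_mul_self_ne_zero ⟨e, by rw [hu1 e (by simp)]; exact one_ne_zero⟩ h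

/-- The code is a line fixed by the translation, so the compression scalar is nonzero, while a
nontrivial translation has trace `0`. Only the purity clause makes this error undetected. -/
theorem not_detects_translation_self (A : Submodule F (Fin N → F)) {e : Fin N → F} (he : e ∈ A)
    (he0 : e ≠ 0) : ¬ Detects (cssCode A A) (translation e) := by
  rintro ⟨c, hc, htr⟩
  have hfin : Module.finrank ℂ (cssCode A A) = 1 := by
    rw [finrank_cssCode le_rfl]; simp
  have hc0 : c = 0 := by
    rw [htr hfin, Matrix.trace]
    simp [translation, he0]
  obtain ⟨u, hu, hu1, -⟩ := exists_mem_cssCode_coset le_rfl A.zero_mem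
  have h := hc u hu u hu
  have huu : ∀ x, u (x - e) = u x := fun x => by
    rw [sub_eq_add_neg, cssCode_apply_add le_rfl hu (A.neg_mem he)]
  rw [inner_translation, hc0, zero_mul] at h
  simp only [huu] at h
  exact sum_star_mul_self_ne_zero ⟨0, by rw [hu1 0 (by simp)]; exact one_ne_zero⟩ h

/-! ### Exact distance of CSS codes -/

/-- The pair `A ≤ B` gives a CSS code of distance exactly `m`, attained at a translation. -/
structure IsCSSPair (A B : Submodule F (Fin N → F)) (m : ℕ) : Prop where
  le : A ≤ B
  le_weight : ∀ x ∈ B, x ∉ A → m ≤ hammingNorm x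
  agree : ∀ S : Finset (Fin N), S.card < m → ∀ x ∈ B, ∃ y ∈ A, ∀ i ∈ S, x i = y i
  attained : ∃ e ∈ B, e ∉ A ∧ hammingNorm e = m

theorem IsCSSPair.isQuantumMinDist {m : ℕ} (h : IsCSSPair A B m) :
    IsQuantumMinDist (cssCode A B) m := by
  classical
  obtain ⟨e, heB, heA, hm⟩ := h.attained
  refine ⟨⟨supp e, translation e, hm, actsOn_translation e,
    not_detects_translation h.le heB heA⟩, ?_⟩
  rintro _ ⟨S, E, rfl, hE, hdet⟩
  by_contra! hS
  refine hdet ⟨_, compressesTo_cssCode h.le hE (fun x hx hxS => ?_) (h.agree S hS), fun h1 => ?_⟩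
  · by_contra hxA
    exact absurd (h.le_weight x hx hxA) (by have := hammingNorm_le_card hxS; omega)
  -- Purity is vacuous here: `A < B` forces dimension at least `q > 1`.
  · rw [finrank_cssCode h.le] at h1
    have hlt := Submodule.finrank_lt_finrank_of_lt (lt_of_le_of_ne h.le fun hh => heA (hh ▸ heB))
    have := Nat.one_lt_pow (n := Module.finrank F B - Module.finrank F A) (by omega)
      (Fintype.one_lt_card (α := F))
    omega

theorem isQuantumMinDist_cssCode_self {m : ℕ} (h : dualCode A = A)
    (hle : ∀ x ∈ A, x ≠ 0 → m ≤ hammingNorm x) (hatt : ∃ e ∈ A, e ≠ 0 ∧ hammingNorm e = m) :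
    IsQuantumMinDist (cssCode A A) m := by
  classical
  obtain ⟨e, heA, he0, hm⟩ := hatt
  refine ⟨⟨supp e, translation e, hm, actsOn_translation e,
    not_detects_translation_self A heA he0⟩, ?_⟩
  rintro _ ⟨S, E, rfl, hE, hdet⟩
  by_contra! hS
  have hzero : ∀ x ∈ A, (∀ i ∉ S, x i = 0) → x = 0 := fun x hx hxS => by
    by_contra hx0
    exact absurd (hle x hx hx0) (by have := hammingNorm_le_card hxS; omega)
  have hagree : ∀ x : Fin N → F, ∃ y ∈ A, ∀ i ∈ S, x i = y i := fun x =>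
    exists_mem_eqOn_of_dotProduct_eq_zero A S x fun v hv hvS => by
      rw [hzero v (h ▸ hv) hvS, zero_dotProduct]
  exact hdet ⟨_, compressesTo_cssCode le_rfl hE (fun x hx _ => hx) fun x _ => hagree x,
    fun _ => sum_div_card_eq_trace hE hzero hagree⟩


end CSS

/-! ### Lowering the distance by shears -/

section Reduction

variable {F : Type*} [Field F] [DecidableEq F] {N : ℕ} {A B : Submodule F (Fin N → F)} {m : ℕ}

/-- A shear that cancels one entry of a word of least weight lowers the distance of a CSS code by
exactly one. -/
theorem IsCSSPair.exists_pred (hm : 1 ≤ m) (h : IsCSSPair A B (m + 1)) :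
    ∃ A' B' : Submodule F (Fin N → F), IsCSSPair A' B' m ∧
      Module.finrank F A' = Module.finrank F A ∧ Module.finrank F B' = Module.finrank F B := by
  obtain ⟨e, heB, heA, hwt⟩ := h.attained
  obtain ⟨i, hi, j, hj, hij⟩ := Finset.one_lt_card.1
    (show 1 < (Finset.univ.filter (e · ≠ 0)).card by unfold hammingNorm at hwt; omega)
  have hi0 : e i ≠ 0 := (Finset.mem_filter.1 hi).2
  -- The shear subtracts `e j / e i` times entry `i` from entry `j`. It kills `e j`, keeps `e i`,
  -- and changes any weight by at most one.
  let f : (Fin N → F) →ₗ[F] F := -(e j / e i) • LinearMap.proj i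
  have hf : f (Pi.single j 1) = 0 := by simp [f, hij]
  let g := LinearEquiv.transvection hf
  have hg : ∀ x k, g x k = if k = j then x j - e j / e i * x i else x k := fun x k => by
    change (x + f x • (Pi.single j 1 : Fin N → F)) k = _
    split_ifs with hk
    · subst hk
      simp [f, sub_eq_add_neg]
    · simp [hk]
  have hmem : ∀ (W : Submodule F (Fin N → F)) (x), g x ∈ W.map g.toLinearMap ↔ x ∈ W :=
    fun W x => by simp
  refine ⟨A.map g.toLinearMap, B.map g.toLinearMap,
    ⟨Submodule.map_mono h.le, ?_, ?_, g e, (hmem B e).2 heB, fun hh => heA ((hmem A e).1 hh), ?_⟩,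
    LinearEquiv.finrank_map_eq g A, LinearEquiv.finrank_map_eq g B⟩
  · rintro _ ⟨x, hx, rfl⟩ hxA
    have hle := h.le_weight x hx fun hh => hxA ((hmem A x).2 hh)
    have hsub : Finset.univ.filter (x · ≠ 0) ⊆
        insert j (Finset.univ.filter (g x · ≠ 0)) := fun k hk => by
      by_cases hkj : k = j
      · simp [hkj]
      · simpa [hkj, hg] using hk
    have hcard := (Finset.card_le_card hsub).trans (Finset.card_insert_le _ _)
    change m + 1 ≤ (Finset.univ.filter (x · ≠ 0)).card at hle
    change m ≤ (Finset.univ.filter (g x · ≠ 0)).card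
    omega
  · rintro S hS _ ⟨x, hx, rfl⟩
    -- Entry `j` after the shear also depends on entry `i`; adding `i` to `S` is affordable because
    -- the old bound is `m + 1`.
    obtain ⟨y, hy, hxy⟩ := h.agree (insert i S)
      (lt_of_le_of_lt (Finset.card_insert_le _ _) (by omega)) x hx
    refine ⟨g y, (hmem A y).2 hy, fun k hk => ?_⟩
    have hxi := hxy i (Finset.mem_insert_self _ _)
    have hxk := hxy k (Finset.mem_insert_of_mem hk)
    change g x k = g y k
    rw [hg, hg]
    split_ifs with hkj
    · rw [hxi, ← hkj, hxk]
    · exact hxk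
  · have hsupp : Finset.univ.filter (g e · ≠ 0) = (Finset.univ.filter (e · ≠ 0)).erase j := by
      ext k
      by_cases hkj : k = j
      · simp [hkj, hg, hi0]
      · simp [hkj, hg]
    change (Finset.univ.filter (g e · ≠ 0)).card = m
    rw [hsupp, Finset.card_erase_of_mem hj]
    unfold hammingNorm at hwt
    omega

theorem IsCSSPair.exists_of_le {m' : ℕ} (hm : 1 ≤ m) (hle : m ≤ m') (h : IsCSSPair A B m') :
    ∃ A' B' : Submodule F (Fin N → F), IsCSSPair A' B' m ∧
      Module.finrank F A' = Module.finrank F A ∧ Module.finrank F B' = Module.finrank F B := by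
  induction m', hle using Nat.le_induction generalizing A B with
  | base => exact ⟨A, B, h, rfl, rfl⟩
  | succ l hl ih =>
    obtain ⟨A₁, B₁, h₁, hA₁, hB₁⟩ := h.exists_pred (hm.trans hl)
    obtain ⟨A₂, B₂, h₂, hA₂, hB₂⟩ := ih h₁
    exact ⟨A₂, B₂, h₂, hA₂.trans hA₁, hB₂.trans hB₁⟩

/-- The CSS construction on a code that contains its dual, with the distance lowered to the
minimum weight of the code if the construction is degenerate. -/
theorem exists_isQuantumCode_of_dualCode_le [Fintype F] {D : Submodule F (Fin N → F)}
    (hD : dualCode D ≤ D) {d : ℕ} (hd : IsLeast {w | ∃ x ∈ D, x ≠ 0 ∧ hammingNorm x = w} d) :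
    ∃ Q : Submodule ℂ (QSpace F N),
      IsQuantumCode Q (2 * Module.finrank F D - N) d := by
  classical
  have hdim := finrank_add_finrank_dualCode D
  obtain ⟨⟨e, heD, he0, hed⟩, hmin⟩ := hd
  have hmin' : ∀ x ∈ D, x ≠ 0 → d ≤ hammingNorm x := fun x hx hx0 => hmin ⟨x, hx, hx0, rfl⟩
  have hd1 : 1 ≤ d := hed ▸ hammingNorm_pos_iff.2 he0
  by_cases hself : dualCode D = D
  · rw [hself] at hdim
    refine ⟨cssCode D D, ?_, isQuantumMinDist_cssCode_self hself hmin' ⟨e, heD, he0, hed⟩⟩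
    rw [finrank_cssCode le_rfl]
    congr 1
    omega
  · have hex : ∃ w, ∃ x ∈ D, x ∉ dualCode D ∧ hammingNorm x = w := by
      obtain ⟨x, hx, hx'⟩ := SetLike.exists_of_lt (lt_of_le_of_ne hD hself)
      exact ⟨_, x, hx, hx', rfl⟩
    have hpair : IsCSSPair (dualCode D) D (Nat.find hex) := by
      refine ⟨hD, fun x hx hx' => Nat.find_min' hex ⟨x, hx, hx', rfl⟩, fun S hS x hx => ?_,
        Nat.find_spec hex⟩
      refine exists_mem_eqOn_of_dotProduct_eq_zero _ S x fun v hv hvS => ?_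
      rw [dualCode_dualCode] at hv
      -- Otherwise `v` would be a word of `D` outside `dualCode D`, of weight at most `S.card`,
      -- below the minimum.
      by_contra hvx
      have hle := Nat.find_min' hex ⟨v, hv, fun hv' => hvx (hv' x hx), rfl⟩
      have := hammingNorm_le_card hvS
      omega
    have hdle : d ≤ Nat.find hex := by
      obtain ⟨x, hx, hx', hw⟩ := Nat.find_spec hex
      rw [← hw]
      exact hmin' x hx fun h0 => hx' (h0 ▸ zero_mem _)
    obtain ⟨A, B, h, hA, hB⟩ := hpair.exists_of_le hd1 hdle
    refine ⟨cssCode A B, ?_, h.isQuantumMinDist⟩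
    rw [finrank_cssCode h.le, hA, hB]
    congr 1
    omega

end Reduction

/-! ## The Gray image of a code -/

section Gray

variable {F : Type*} [Field F]

/-- The rows are pairwise orthogonal over the integers, each of squared length `36 + 4 + 9 + 36 + 36
= 121`. -/
theorem grayMatrix_mul_transpose : grayMatrix F * (grayMatrix F).transpose = (121 : F) • 1 := by
  ext i j
  fin_cases i <;> fin_cases j <;>
    simp [grayMatrix, Matrix.mul_apply, Fin.sum_univ_five] <;> norm_num

theorem transpose_mul_grayMatrix : (grayMatrix F).transpose * grayMatrix F = (121 : F) • 1 := by
  ext i j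
  fin_cases i <;> fin_cases j <;>
    simp [grayMatrix, Matrix.mul_apply, Fin.sum_univ_five] <;> norm_num

variable {a : F} (ha : a ^ 2 = -1)

theorem gray_apply (r : R F) : gray ha r = Matrix.vecMul (coord ha · r) (grayMatrix F) := rfl

theorem gray_dotProduct_gray (r s : R F) :
    gray ha r ⬝ᵥ gray ha s = 121 * ∑ j, coord ha j (r * s) := by
  rw [gray_apply, gray_apply, ← Matrix.dotProduct_mulVec, ← Matrix.vecMul_transpose,
    Matrix.vecMul_vecMul, grayMatrix_mul_transpose, Matrix.vecMul_smul, Matrix.vecMul_one,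
    dotProduct_smul, smul_eq_mul]
  simp [dotProduct]

variable {n : ℕ}

/-- The position in `F⁵ⁿ` of the `j`-th entry of the `i`-th block. -/
def blockEquiv (n : ℕ) : Fin n × Fin 5 ≃ Fin (5 * n) :=
  finProdFinEquiv.trans (finCongr (Nat.mul_comm n 5))

theorem grayVec_blockEquiv (x : Fin n → R F) (i : Fin n) (j : Fin 5) :
    grayVec ha n x (blockEquiv n (i, j)) = gray ha (x i) j := by
  have h := finProdFinEquiv.symm_apply_apply (i, j)
  have h1 : (finProdFinEquiv (i, j)).divNat = i := congrArg Prod.fst h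
  have h2 : (finProdFinEquiv (i, j)).modNat = j := congrArg Prod.snd h
  change gray ha (x (finProdFinEquiv (i, j)).divNat) (finProdFinEquiv (i, j)).modNat = _
  rw [h1, h2]

theorem grayVec_dotProduct_grayVec (x y : Fin n → R F) :
    grayVec ha n x ⬝ᵥ grayVec ha n y = 121 * ∑ j, coord ha j (x ⬝ᵥ y) := by
  have h : grayVec ha n x ⬝ᵥ grayVec ha n y = ∑ i, gray ha (x i) ⬝ᵥ gray ha (y i) := by
    simp_rw [dotProduct]
    rw [← (blockEquiv n).sum_comp, Fintype.sum_prod_type]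
    simp [grayVec_blockEquiv]
  rw [h, Finset.sum_congr rfl fun i _ => gray_dotProduct_gray ha (x i) (y i), ← Finset.mul_sum,
    Finset.sum_comm]
  simp [dotProduct, map_sum]

theorem hammingNorm_grayVec [DecidableEq F] (x : Fin n → R F) :
    hammingNorm (grayVec ha n x) = ∑ i, leeWeight ha (x i) := by
  simp_rw [leeWeight, hammingNorm, Finset.card_filter]
  rw [← (blockEquiv n).sum_comp, Fintype.sum_prod_type]
  simp [grayVec_blockEquiv]

theorem leeDist_eq [DecidableEq F] (x y : Fin n → R F) :
    leeDist ha x y = hammingNorm (grayVec ha n (x - y)) := by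
  rw [hammingNorm_grayVec]; rfl

/-- Testing against the idempotent `eta a i` isolates the `i`-th coordinate of `r`. -/
theorem eq_zero_of_sum_coord_mul_eq_zero (h2 : (2 : F) ≠ 0) {r : R F}
    (h : ∀ s, ∑ j, coord ha j (s * r) = 0) : r = 0 := by
  refine coord_ext h2 ha fun i => ?_
  simpa [coord_eta h2 ha] using h (eta a i)

theorem gray_injective (h2 : (2 : F) ≠ 0) (h121 : (121 : F) ≠ 0) :
    Function.Injective (gray ha) := by
  refine (injective_iff_map_eq_zero _).2 fun r hr =>
    eq_zero_of_sum_coord_mul_eq_zero ha h2 fun s => ?_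
  have h := gray_dotProduct_gray ha s r
  rw [hr, dotProduct_zero] at h
  exact (mul_eq_zero.1 h.symm).resolve_left h121

theorem gray_surjective (h2 : (2 : F) ≠ 0) (h121 : (121 : F) ≠ 0) :
    Function.Surjective (gray ha) := by
  intro y
  refine ⟨∑ j, ((121 : F)⁻¹ • Matrix.vecMul y (grayMatrix F).transpose) j • eta a j, ?_⟩
  have h : (fun i => coord ha i
      (∑ j, ((121 : F)⁻¹ • Matrix.vecMul y (grayMatrix F).transpose) j • eta a j)) =
      (121 : F)⁻¹ • Matrix.vecMul y (grayMatrix F).transpose :=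
    funext fun i => (eq_coord_of_eq_sum h2 ha _ _ rfl i).symm
  rw [gray_apply, h, Matrix.smul_vecMul, Matrix.vecMul_vecMul, transpose_mul_grayMatrix,
    Matrix.vecMul_smul, Matrix.vecMul_one, inv_smul_smul₀ h121]

theorem grayVec_injective (h2 : (2 : F) ≠ 0) (h121 : (121 : F) ≠ 0) :
    Function.Injective (grayVec ha n) := by
  intro x y h
  funext i
  refine gray_injective ha h2 h121 (funext fun j => ?_)
  rw [← grayVec_blockEquiv, ← grayVec_blockEquiv, h]

theorem grayVec_surjective (h2 : (2 : F) ≠ 0) (h121 : (121 : F) ≠ 0) :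
    Function.Surjective (grayVec ha n) := by
  intro y
  choose x hx using fun i => gray_surjective ha h2 h121 fun j => y (blockEquiv n (i, j))
  refine ⟨x, funext fun m => ?_⟩
  obtain ⟨⟨i, j⟩, rfl⟩ := (blockEquiv n).surjective m
  rw [grayVec_blockEquiv, hx]

/-- The dual of the Gray image is contained in the Gray image of the dual. -/
theorem dualCode_map_grayVec_le (h2 : (2 : F) ≠ 0) (h121 : (121 : F) ≠ 0)
    (C : Submodule (R F) (Fin n → R F)) :
    dualCode ((C.restrictScalars F).map (grayVec ha n)) ≤
      ((dualCode C).restrictScalars F).map (grayVec ha n) := by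
  intro y hy
  obtain ⟨x, rfl⟩ := grayVec_surjective ha h2 h121 y
  refine ⟨x, fun z hz => eq_zero_of_sum_coord_mul_eq_zero ha h2 fun s => ?_, rfl⟩
  -- Closure of `C` under all of `R` turns one scalar equation into a family indexed by `s`, enough
  -- for the trace form to force `x ⬝ᵥ z = 0`.
  have h := hy _ ⟨s • z, C.smul_mem s hz, rfl⟩
  rw [grayVec_dotProduct_grayVec, dotProduct_smul] at h
  exact (mul_eq_zero.1 h).resolve_left h121

theorem isLeast_hammingNorm_map_grayVec [DecidableEq F] (h2 : (2 : F) ≠ 0) (h121 : (121 : F) ≠ 0)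
    {C : Submodule (R F) (Fin n → R F)} {d : ℕ} (hd : IsMinLeeDist ha C d) :
    IsLeast {w | ∃ x ∈ (C.restrictScalars F).map (grayVec ha n), x ≠ 0 ∧ hammingNorm x = w} d := by
  rw [IsMinLeeDist] at hd
  convert hd using 1
  ext w
  constructor
  · rintro ⟨_, ⟨x, hx, rfl⟩, hx0, hw⟩
    refine ⟨x, hx, 0, C.zero_mem, ?_, by rw [leeDist_eq, sub_zero, hw]⟩
    rintro rfl
    exact hx0 (map_zero _)
  · rintro ⟨x, hx, y, hy, hxy, hw⟩
    refine ⟨_, ⟨x - y, C.sub_mem hx hy, rfl⟩, fun h0 => hxy ?_, by rw [← leeDist_eq, hw]⟩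
    exact sub_eq_zero.1 (grayVec_injective ha h2 h121 (h0.trans (map_zero _).symm))

end Gray

end GrayQuantum

end

theorem mainTheorem1 (p : ℕ) (hp : p.Prime) (hp4 : 4 ∣ p - 1)
    (F : Type*) [Field F] [Fintype F] [DecidableEq F] [CharP F p]
    (a : F) (ha : a ^ 2 = -1)
    (n : ℕ) (C : Submodule (GrayQuantum.R F) (Fin n → GrayQuantum.R F))
    (hcyc : GrayQuantum.IsCyclicCode C)
    (k d : ℕ)
    (hk : Module.finrank F ((C.restrictScalars F).map (GrayQuantum.grayVec ha n)) = k)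
    (hd : GrayQuantum.IsMinLeeDist ha C d)
    (hdual : GrayQuantum.dualCode C ≤ C) :
    5 * n ≤ 2 * k ∧
      ∃ Q : Submodule ℂ (GrayQuantum.QSpace F (5 * n)),
        GrayQuantum.IsQuantumCode Q (2 * k - 5 * n) d := by
  have hp1 := hp.one_lt
  have h2 : (2 : F) ≠ 0 := fun h => by
    have hdvd := (CharP.cast_eq_zero_iff F p 2).1 (by exact_mod_cast h)
    have := (Nat.prime_dvd_prime_iff_eq hp Nat.prime_two).1 hdvd
    omega
  have h121 : (121 : F) ≠ 0 := fun h => by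
    have hdvd := (CharP.cast_eq_zero_iff F p 121).1 (by exact_mod_cast h)
    have := (Nat.prime_dvd_prime_iff_eq hp (by norm_num : Nat.Prime 11)).1
      (hp.dvd_of_dvd_pow (n := 2) (by norm_num; exact hdvd))
    -- `p = 11` contradicts `4 ∣ p - 1`.
    omega
  have hD := (GrayQuantum.dualCode_map_grayVec_le ha h2 h121 C).trans
    (Submodule.map_mono (p' := C.restrictScalars F) hdual)
  have hdim := GrayQuantum.finrank_add_finrank_dualCode
    ((C.restrictScalars F).map (GrayQuantum.grayVec ha n))
  have hle := Submodule.finrank_mono hD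
  subst hk
  exact ⟨by omega, GrayQuantum.exists_isQuantumCode_of_dualCode_le hD
    (GrayQuantum.isLeast_hammingNorm_map_grayVec ha h2 h121 hd)⟩
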